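/- Let $n,q$ be positive integers and let $M$ be a smooth ($C^\infty$, Hausdorff, second countable) manifold without boundary of dimension $2n+q$. A $q$-cosymplectic structure on $M$ consists of a closed 2-form $\Omega$, closed 1-forms $\lambda_1,\dots,\lambda_q$ that are linearly independent at every point, and a splitting $TM=\mathcal R\oplus\xi$ such that (i) $\xi=\bigcap_{i=1}^q\ker\lambda_i$; (ii) there is a unique collection of linearly independent smooth vector fields $R_1,\dots,R_q$ tangent to $\mathcal R$ with $\lambda_i(R_j)=\delta_{ij}$ for all $i,j$ (the Reeb vector fields); (iii) $\mathcal R=\operatorname{span}\{R_1,\dots,R_q\}$; (iv) $\ker\Omega=\mathcal R$ and $\Omega|_\xi$ is non-degenerate. The bundle map $b:TM\to T^*M$, $b(v)=i_v\Omega+\sum_{i=1}^q\lambda_i(v)\lambda_i$, is then an isomorphism on every fibre, and for $f\in C^\infty(M)$ the Hamiltonian vector field of $f$ is $X_f:=b^{-1}\bigl(df-\sum_{i=1}^q R_i(f)\,\lambda_i\bigr)$. **Theorem.** Let $(M,\Omega,\lambda_1,\dots,\lambda_q)$ be a $q$-cosymplectic manifold. For every $f\in C^\infty(M)$ the vector field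 $X_f$ is smooth, and it is the unique vector field with $$i_{X_f}\Omega=df-\sum_{i=1}^q R_i(f)\,\lambda_i,\qquad \lambda_i(X_f)=0\quad(i=1,\dots,q).$$ The formula $\{f,g\}:=\Omega(X_f,X_g)$ defines a map $C^\infty(M)\times C^\infty(M)\to C^\infty(M)$ which is a Poisson bracket: it is $\mathbb R$-bilinear and antisymmetric, and for all $f,g,h\in C^\infty(M)$ $$\{\{f,g\},h\}+\{\{g,h\},f\}+\{\{h,f\},g\}=0,\qquad \{fg,h\}=f\{g,h\}+g\{f,h\}.$$ Moreover $X_{\{f,g\}}=-[X_f,X_g]$ for all $f,g\in C^\infty(M)$. -/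

import Mathlib

open scoped Manifold ContDiff

noncomputable section

namespace QCosymplectic

variable {E : Type*} [NormedAddCommGroup E] [NormedSpace ℝ E]
  {H : Type*} [TopologicalSpace H] (I : ModelWithCorners ℝ E H)
  {M : Type*} [TopologicalSpace M] [ChartedSpace H M]

/-- (Not necessarily smooth) vector fields on `M`. -/
abbrev VField (M : Type*) [TopologicalSpace M] [ChartedSpace H M] : Type _ :=
  Π x : M, TangentSpace I x

/-- (Not necessarily smooth) fields of covectors on `M`. -/
abbrev CovectorField (M : Type*) [TopologicalSpace M] [ChartedSpace H M] : Type _ :=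
  Π x : M, TangentSpace I x →L[ℝ] ℝ

/-- (Not necessarily smooth) fields of bilinear forms on the tangent spaces of `M`. -/
abbrev BilinField (M : Type*) [TopologicalSpace M] [ChartedSpace H M] : Type _ :=
  Π x : M, TangentSpace I x →L[ℝ] TangentSpace I x →L[ℝ] ℝ

section Smooth

variable [IsManifold I ∞ M]

/-- `X` is a smooth section of the tangent bundle. -/
def IsSmoothVField (X : VField I M) : Prop :=
  ContMDiff I I.tangent ∞ fun x => (⟨x, X x⟩ : TangentBundle I M)

/-- `α` is a smooth section of the cotangent bundle, that is, a differential 1-form. -/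
def IsOneForm (α : CovectorField I M) : Prop :=
  ContMDiff I (I.prod 𝓘(ℝ, E →L[ℝ] ℝ)) ∞
    fun x => Bundle.TotalSpace.mk' (E →L[ℝ] ℝ)
      (E := fun y : M => TangentSpace I y →L[ℝ] ℝ) x (α x)

/-- `β` is a smooth section of `T*M ⊗ T*M` which is alternating, that is, a differential
2-form. -/
def IsTwoForm (β : BilinField I M) : Prop :=
  ContMDiff I (I.prod 𝓘(ℝ, E →L[ℝ] E →L[ℝ] ℝ)) ∞
    (fun x => Bundle.TotalSpace.mk' (E →L[ℝ] E →L[ℝ] ℝ)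
      (E := fun y : M => TangentSpace I y →L[ℝ] TangentSpace I y →L[ℝ] ℝ) x (β x)) ∧
  ∀ (x : M) (v : TangentSpace I x), β x v v = 0

end Smooth

/-- The derivative `X f` of the function `f` along the vector field `X`. -/
def dirDeriv (X : VField I M) (f : M → ℝ) (x : M) : ℝ := mvfderiv I f x (X x)

/-- The exterior derivative of a 1-form, evaluated on two vector fields:
`dα(X, Y) = X(α(Y)) - Y(α(X)) - α([X, Y])`. -/
def extDeriv₁ (α : CovectorField I M) (X Y : VField I M) (x : M) : ℝ :=
  dirDeriv I X (fun y => α y (Y y)) x - dirDeriv I Y (fun y => α y (X y)) x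
    - α x (VectorField.mlieBracket I X Y x)

/-- The exterior derivative of a 2-form, evaluated on three vector fields:
`dβ(X, Y, Z) = X(β(Y, Z)) - Y(β(X, Z)) + Z(β(X, Y)) - β([X, Y], Z) + β([X, Z], Y) - β([Y, Z], X)`.
-/
def extDeriv₂ (β : BilinField I M) (X Y Z : VField I M) (x : M) : ℝ :=
  dirDeriv I X (fun y => β y (Y y) (Z y)) x - dirDeriv I Y (fun y => β y (X y) (Z y)) x
    + dirDeriv I Z (fun y => β y (X y) (Y y)) x
    - β x (VectorField.mlieBracket I X Y x) (Z x)
    + β x (VectorField.mlieBracket I X Z x) (Y x)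
    - β x (VectorField.mlieBracket I Y Z x) (X x)

section Closed

variable [IsManifold I ∞ M]

/-- The 1-form `α` is closed: `dα = 0`. -/
def IsClosedOneForm (α : CovectorField I M) : Prop :=
  ∀ X Y : VField I M, IsSmoothVField I X → IsSmoothVField I Y →
    ∀ x, extDeriv₁ I α X Y x = 0

/-- The 2-form `β` is closed: `dβ = 0`. -/
def IsClosedTwoForm (β : BilinField I M) : Prop :=
  ∀ X Y Z : VField I M, IsSmoothVField I X → IsSmoothVField I Y → IsSmoothVField I Z →
    ∀ x, extDeriv₂ I β X Y Z x = 0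

/-- `R₁, …, R_q` are pointwise linearly independent smooth vector fields, tangent to the
distribution `D`, and `λᵢ(Rⱼ) = δᵢⱼ`. -/
structure IsReebFrame {q : ℕ} (lam : Fin q → CovectorField I M)
    (D : Π x : M, Submodule ℝ (TangentSpace I x)) (R : Fin q → VField I M) : Prop where
  smooth : ∀ i, IsSmoothVField I (R i)
  linearIndependent : ∀ x, LinearIndependent ℝ fun i => R i x
  tangent : ∀ i x, R i x ∈ D x
  dual : ∀ i j x, lam i x (R j x) = if i = j then 1 else 0

end Closed

/-- The distribution `ξ = ⋂ᵢ ker λᵢ`. -/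
def horizontal {q : ℕ} (lam : Fin q → CovectorField I M) (x : M) :
    Submodule ℝ (TangentSpace I x) :=
  ⨅ i, LinearMap.ker (lam i x : TangentSpace I x →ₗ[ℝ] ℝ)

/-- A `q`-cosymplectic structure on `M`. -/
structure QCosymplecticStructure (q : ℕ) (M : Type*) [TopologicalSpace M] [ChartedSpace H M]
    [IsManifold I ∞ M] where
  /-- the 2-form `Ω` -/
  Ω : BilinField I M
  /-- the 1-forms `λ₁, …, λ_q` -/
  lam : Fin q → CovectorField I M
  /-- the Reeb distribution `𝓡` -/
  reebDist : Π x : M, Submodule ℝ (TangentSpace I x)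
  isTwoForm : IsTwoForm I Ω
  closed_Ω : IsClosedTwoForm I Ω
  isOneForm : ∀ i, IsOneForm I (lam i)
  closed_lam : ∀ i, IsClosedOneForm I (lam i)
  linearIndependent_lam : ∀ x, LinearIndependent ℝ fun i => lam i x
  /-- `TM = 𝓡 ⊕ ξ` -/
  splitting : ∀ x, IsCompl (reebDist x) (horizontal I lam x)
  existsUnique_reeb : ∃! R : Fin q → VField I M, IsReebFrame I lam reebDist R
  /-- `𝓡 = span {R₁, …, R_q}` -/
  span_reeb : ∀ R : Fin q → VField I M, IsReebFrame I lam reebDist R →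
    ∀ x, reebDist x = Submodule.span ℝ (Set.range fun i => R i x)
  /-- `ker Ω = 𝓡` -/
  ker_Ω : ∀ x, LinearMap.ker (Ω x : TangentSpace I x →ₗ[ℝ] TangentSpace I x →L[ℝ] ℝ) = reebDist x
  /-- `Ω` restricted to `ξ` is non-degenerate -/
  nondegenerate : ∀ x, ∀ v ∈ horizontal I lam x,
    (∀ w ∈ horizontal I lam x, Ω x v w = 0) → v = 0

namespace QCosymplecticStructure

variable {I} {q : ℕ} [IsManifold I ∞ M] (S : QCosymplecticStructure I q M)

/-- The Reeb vector fields `R₁, …, R_q`. -/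
def reeb : Fin q → VField I M := S.existsUnique_reeb.choose

theorem isReebFrame_reeb : IsReebFrame I S.lam S.reebDist S.reeb :=
  S.existsUnique_reeb.choose_spec.1

/-- The bundle morphism `b : TM → T*M`, `v ↦ i_v Ω + ∑ᵢ λᵢ(v) λᵢ`, on the fibre over `x`. -/
def flat (x : M) : TangentSpace I x →ₗ[ℝ] (TangentSpace I x →L[ℝ] ℝ) where
  toFun v := S.Ω x v + ∑ i, S.lam i x v • S.lam i x
  map_add' v w := by
    simp only [map_add, add_smul, Finset.sum_add_distrib]
    abel
  map_smul' c v := by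
    simp only [map_smul, smul_add, Finset.smul_sum, smul_eq_mul, mul_smul, RingHom.id_apply]

theorem flat_injective (x : M) : Function.Injective (S.flat x) := by
  have hR := S.isReebFrame_reeb
  have hker : ∀ j, S.Ω x (S.reeb j x) = 0 := by
    intro j
    have h := hR.tangent j x
    rw [← S.ker_Ω x] at h
    simpa using h
  have hskew : ∀ v w : TangentSpace I x, S.Ω x v w = - S.Ω x w v := by
    intro v w
    have h := S.isTwoForm.2 x (v + w)
    simp only [map_add, add_apply, S.isTwoForm.2 x] at h
    linarith
  rw [injective_iff_map_eq_zero]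
  intro v hv
  have hv' : ∀ w, S.Ω x v w + ∑ i, S.lam i x v * S.lam i x w = 0 := by
    intro w
    have h := congrArg (fun φ : TangentSpace I x →L[ℝ] ℝ => φ w) hv
    simpa [flat] using h
  have hlam : ∀ j, S.lam j x v = 0 := by
    intro j
    have h := hv' (S.reeb j x)
    rw [hskew, hker] at h
    simpa [hR.dual] using h
  have hhor : v ∈ horizontal I S.lam x := by
    simp only [horizontal, Submodule.mem_iInf]
    intro i
    simpa using hlam i
  refine S.nondegenerate x v hhor fun w _ => ?_
  simpa [hlam] using hv' w

variable [FiniteDimensional ℝ E]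

/-- The isomorphism `b : T_x M ≃ T_x^* M`. -/
def flatEquiv (x : M) : TangentSpace I x ≃ₗ[ℝ] (TangentSpace I x →L[ℝ] ℝ) :=
  haveI : FiniteDimensional ℝ (TangentSpace I x) := inferInstanceAs (FiniteDimensional ℝ E)
  haveI : T2Space (TangentSpace I x) := inferInstanceAs (T2Space E)
  haveI : FiniteDimensional ℝ (TangentSpace I x →L[ℝ] ℝ) :=
    inferInstanceAs (FiniteDimensional ℝ (E →L[ℝ] ℝ))
  LinearEquiv.ofInjectiveOfFinrankEq (S.flat x) (S.flat_injective x)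
    (((LinearMap.toContinuousLinearMap (𝕜 := ℝ) (E := TangentSpace I x)
      (F' := ℝ)).finrank_eq.symm.trans Subspace.dual_finrank_eq).symm)

theorem flatEquiv_apply (x : M) (v : TangentSpace I x) :
    S.flatEquiv x v = S.Ω x v + ∑ i, S.lam i x v • S.lam i x := rfl

/-- The Hamiltonian vector field `X_f = b⁻¹(df - ∑ᵢ (Rᵢ f) λᵢ)`. -/
def hamiltonianVField (f : M → ℝ) : VField I M := fun x =>
  (S.flatEquiv x).symm (mvfderiv I f x - ∑ i, dirDeriv I (S.reeb i) f x • S.lam i x)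

/-- The bracket `{f, g} = Ω(X_f, X_g)`. -/
def bracket (f g : M → ℝ) (x : M) : ℝ :=
  S.Ω x (S.hamiltonianVField f x) (S.hamiltonianVField g x)

end QCosymplecticStructure

/-- A Poisson bracket on a commutative `ℝ`-algebra: a bilinear, antisymmetric operation which
satisfies the Jacobi identity and the Leibniz rule. -/
structure IsPoissonBracket {A : Type*} [CommRing A] [Algebra ℝ A] (B : A → A → A) : Prop where
  add_left : ∀ f g h, B (f + g) h = B f h + B g h
  smul_left : ∀ (c : ℝ) (f g), B (c • f) g = c • B f g
  add_right : ∀ f g h, B f (g + h) = B f g + B f h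
  smul_right : ∀ (c : ℝ) (f g), B f (c • g) = c • B f g
  antisymm : ∀ f g, B f g = - B g f
  jacobi : ∀ f g h, B (B f g) h + B (B g h) f + B (B h f) g = 0
  leibniz : ∀ f g h, B (f * g) h = f * B g h + g * B f h

end QCosymplectic

end

/-!
For a vector field `v`, the equations `i_v Ω = df - ∑ᵢ (Rᵢ f) λᵢ` and `λᵢ(v) = 0` together say that
`b(v) = df - ∑ᵢ (Rᵢ f) λᵢ`; conversely, evaluating this last equation on `Rⱼ` gives `λⱼ(v) = 0`,
because `Ω` and the right-hand side vanish there (`eq_hamiltonianVField_iff`). Smoothness of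
`X_f` is a statement about bundles: if a smooth bundle morphism is bijective on fibres, then a
section whose image is smooth is itself smooth, because inversion of continuous linear maps is
smooth (`contMDiff_of_clm_bundle_apply`).

On vectors in `ξ = ⋂ᵢ ker λᵢ` the form `i_{X_f} Ω` is just `df`. Since `X_g` takes values in `ξ`, it
follows that `{f, g} = X_g f`, which together with antisymmetry yields bilinearity and the Leibniz
rule.

For `X_{ {f, g} } = -[X_f, X_g]`, write `X = X_f`, `Y = X_g`. As `dλᵢ = 0`, the distribution `ξ` is
involutive; in particular `[X, Y]` lies in `ξ`. Given a smooth field `Z` with values in `ξ`, every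
term of `dΩ(X, Y, Z) = 0` can be expressed through derivatives of `f` and `g`:
`X Z g - Y Z f + Z {f, g} - Ω([X, Y], Z) - [X, Z] g + [Y, Z] f = 0`, and `X g = -{f, g}`,
`Y f = {f, g}` reduce this to `Ω([X, Y], Z) = -Z {f, g}`. Every vector of `ξ` extends to such a field
`Z`, and on the Reeb directions `i_{[X, Y]} Ω` vanishes, so `-[X, Y]` satisfies the equations that
characterize `X_{ {f, g} }` (`hamiltonianVField_bracket`).

Since `{{f, g}, h} = -X_{ {f, g} } h = [X, Y] h`, `{{g, h}, f} = -X (Y h)` and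
`{{h, f}, g} = Y (X h)`, the Jacobi identity is `[X, Y] h = X (Y h) - Y (X h)`. This commutator
formula is itself deduced from the Jacobi identity for vector fields: comparing the coefficients of
a field `Z` with `Z x ≠ 0` in `[X, [Y, h Z]] = [[X, Y], h Z] + [Y, [X, h Z]]` gives it (`dirDeriv_mlieBracket`).
-/

namespace QCosymplectic

open Bundle ContinuousLinearMap

/-! ### Smooth sections of hom bundles -/

section Bundles

variable {B F₁ F₂ : Type*} {n : WithTop ℕ∞}
  {E₁ : B → Type*} [∀ x, AddCommGroup (E₁ x)] [∀ x, Module ℝ (E₁ x)]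
  [NormedAddCommGroup F₁] [NormedSpace ℝ F₁]
  [TopologicalSpace (TotalSpace F₁ E₁)] [∀ x, TopologicalSpace (E₁ x)]
  {E₂ : B → Type*} [∀ x, AddCommGroup (E₂ x)] [∀ x, Module ℝ (E₂ x)]
  [NormedAddCommGroup F₂] [NormedSpace ℝ F₂]
  [TopologicalSpace (TotalSpace F₂ E₂)] [∀ x, TopologicalSpace (E₂ x)]
  {EB : Type*} [NormedAddCommGroup EB] [NormedSpace ℝ EB] {HB : Type*} [TopologicalSpace HB]
  {IB : ModelWithCorners ℝ EB HB} [TopologicalSpace B] [ChartedSpace HB B]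
  [FiberBundle F₁ E₁] [VectorBundle ℝ F₁ E₁] [FiberBundle F₂ E₂] [VectorBundle ℝ F₂ E₂]
  [∀ x, IsTopologicalAddGroup (E₂ x)] [∀ x, ContinuousSMul ℝ (E₂ x)]

/-- If `φ` is a `C^n` bundle morphism which is bijective on every fibre, then a section `v` such that
`φ v` is `C^n` is itself `C^n`: in local trivializations, `v` is obtained from `φ v` by applying the
inverse of `φ`, and inversion is smooth on the invertible continuous linear maps. -/
theorem contMDiff_of_clm_bundle_apply [FiniteDimensional ℝ F₁]
    {φ : ∀ x, E₁ x →L[ℝ] E₂ x} {v : ∀ x, E₁ x} (hbij : ∀ x, Function.Bijective (φ x))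
    (hφ : ContMDiff IB (IB.prod 𝓘(ℝ, F₁ →L[ℝ] F₂)) n fun x =>
      TotalSpace.mk' (F₁ →L[ℝ] F₂) (E := fun y => E₁ y →L[ℝ] E₂ y) x (φ x))
    (hv : ContMDiff IB (IB.prod 𝓘(ℝ, F₂)) n fun x => TotalSpace.mk' F₂ x (φ x (v x))) :
    ContMDiff IB (IB.prod 𝓘(ℝ, F₁)) n fun x => TotalSpace.mk' F₁ x (v x) := by
  intro x₀
  have hφ₀ := ((contMDiffAt_hom_bundle _).1 (hφ x₀)).2
  have hv₀ := (contMDiffAt_totalSpace.1 (hv x₀)).2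
  rw [contMDiffAt_totalSpace]
  refine ⟨contMDiffAt_id, ?_⟩
  dsimp only at hφ₀ hv₀ ⊢
  set t₁ := trivializationAt F₁ E₁ x₀
  set t₂ := trivializationAt F₂ E₂ x₀
  have h₁ := mem_baseSet_trivializationAt F₁ E₁ x₀
  have h₂ := mem_baseSet_trivializationAt F₂ E₂ x₀
  have key : ∀ x, x ∈ t₁.baseSet → x ∈ t₂.baseSet → ∃ e : F₁ ≃L[ℝ] F₂,
      (e : F₁ →L[ℝ] F₂) = inCoordinates F₁ E₁ F₂ E₂ x₀ x x₀ x (φ x) := by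
    intro x hx₁ hx₂
    let e' : F₁ ≃ₗ[ℝ] F₂ :=
      ((t₁.continuousLinearEquivAt ℝ x hx₁).symm.toLinearEquiv.trans
        (LinearEquiv.ofBijective (φ x : E₁ x →ₗ[ℝ] E₂ x) (hbij x))).trans
        (t₂.continuousLinearEquivAt ℝ x hx₂).toLinearEquiv
    have : FiniteDimensional ℝ F₂ := e'.finiteDimensional
    refine ⟨e'.toContinuousLinearEquiv, ?_⟩
    rw [inCoordinates_eq hx₁ hx₂]
    ext v
    simp [e', t₁, t₂]
  obtain ⟨e₀, he₀⟩ := key x₀ h₁ h₂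
  have : CompleteSpace F₁ := FiniteDimensional.complete ℝ F₁
  have hinv : ContMDiffAt IB 𝓘(ℝ, F₂ →L[ℝ] F₁) n
      (fun x => (inCoordinates F₁ E₁ F₂ E₂ x₀ x x₀ x (φ x)).inverse) x₀ := by
    have h := contDiffAt_map_inverse (n := n) e₀
    rw [he₀] at h
    exact h.contMDiffAt.comp x₀ hφ₀
  refine (hinv.clm_apply hv₀).congr_of_eventuallyEq ?_
  filter_upwards [t₁.open_baseSet.mem_nhds h₁, t₂.open_baseSet.mem_nhds h₂] with x hx₁ hx₂
  obtain ⟨e, he⟩ := key x hx₁ hx₂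
  have hev : (t₂ ⟨x, φ x (v x)⟩).2 = e (t₁ ⟨x, v x⟩).2 := by
    rw [← ContinuousLinearEquiv.coe_coe e, he, inCoordinates_eq hx₁ hx₂]
    simp [t₁, t₂, hx₁]
  rw [← he, inverse_equiv, hev]
  simp

theorem contMDiff_smulRight_section {φ : ∀ x, E₁ x →L[ℝ] ℝ} {s : ∀ x, E₂ x}
    (hφ : ContMDiff IB (IB.prod 𝓘(ℝ, F₁ →L[ℝ] ℝ)) n fun x =>
      TotalSpace.mk' (F₁ →L[ℝ] ℝ) (E := fun y => E₁ y →L[ℝ] Trivial B ℝ y) x (φ x))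
    (hs : ContMDiff IB (IB.prod 𝓘(ℝ, F₂)) n fun x => TotalSpace.mk' F₂ x (s x)) :
    ContMDiff IB (IB.prod 𝓘(ℝ, F₁ →L[ℝ] F₂)) n fun x =>
      TotalSpace.mk' (F₁ →L[ℝ] F₂) (E := fun y => E₁ y →L[ℝ] E₂ y) x ((φ x).smulRight (s x)) := by
  intro x₀
  have hφ₀ := ((contMDiffAt_hom_bundle _).1 (hφ x₀)).2
  have hs₀ := (contMDiffAt_totalSpace.1 (hs x₀)).2
  rw [contMDiffAt_hom_bundle]
  refine ⟨contMDiffAt_id, ?_⟩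
  dsimp only at hφ₀ hs₀ ⊢
  have hL : ContMDiffAt IB 𝓘(ℝ, F₁ →L[ℝ] F₂) n (fun x =>
      (inCoordinates F₁ E₁ ℝ (Trivial B ℝ) x₀ x x₀ x (φ x)).smulRight
        (trivializationAt F₂ E₂ x₀ ⟨x, s x⟩).2) x₀ :=
    (isBoundedBilinearMap_smulRight (𝕜 := ℝ) (E := F₁) (F := F₂)).contDiff.contDiffAt.contMDiffAt.comp
      x₀ (hφ₀.prodMk_space hs₀)
  refine hL.congr_of_eventuallyEq ?_
  filter_upwards [(trivializationAt F₂ E₂ x₀).open_baseSet.mem_nhds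
    (mem_baseSet_trivializationAt F₂ E₂ x₀)] with x hx
  ext w
  simp [inCoordinates, Trivialization.coe_linearMapAt_of_mem _ hx]

end Bundles

/-! ### Vector fields and forms -/

variable {E : Type*} [NormedAddCommGroup E] [NormedSpace ℝ E]
  {H : Type*} [TopologicalSpace H] {I : ModelWithCorners ℝ E H}
  {M : Type*} [TopologicalSpace M] [ChartedSpace H M] [IsManifold I ∞ M]

theorem isOneForm_mvfderiv {f : M → ℝ} (hf : ContMDiff I 𝓘(ℝ) ∞ f) :
    IsOneForm I (mvfderiv I f) := by
  intro x₀
  have h := (hf x₀).mfderiv_const (m := ∞) (by simp)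
  refine (contMDiffAt_hom_bundle _).2 ⟨contMDiffAt_id, ?_⟩
  refine h.congr_of_eventuallyEq (Filter.Eventually.of_forall fun x => ?_)
  ext v
  simp [inTangentCoordinates, inCoordinates, mvfderiv]
  rfl

theorem IsOneForm.contMDiff_apply {α : CovectorField I M} {X : VField I M}
    (hα : IsOneForm I α) (hX : IsSmoothVField I X) :
    ContMDiff I 𝓘(ℝ) ∞ fun x => α x (X x) := by
  have h := ContMDiff.clm_bundle_apply (E₂ := Trivial M ℝ) hα hX
  intro x₀
  exact (contMDiffAt_totalSpace.1 (h x₀)).2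

theorem IsTwoForm.contMDiff_apply {β : BilinField I M} {X Y : VField I M}
    (hβ : IsTwoForm I β) (hX : IsSmoothVField I X) (hY : IsSmoothVField I Y) :
    ContMDiff I 𝓘(ℝ) ∞ fun x => β x (X x) (Y x) :=
  IsOneForm.contMDiff_apply (ContMDiff.clm_bundle_apply hβ.1 hX) hY

theorem IsSmoothVField.contMDiff_dirDeriv {X : VField I M} {f : M → ℝ}
    (hX : IsSmoothVField I X) (hf : ContMDiff I 𝓘(ℝ) ∞ f) :
    ContMDiff I 𝓘(ℝ) ∞ (dirDeriv I X f) :=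
  (isOneForm_mvfderiv hf).contMDiff_apply hX

/-- Every tangent vector extends to a global smooth vector field: cut off a local extension by a bump
function. -/
theorem exists_isSmoothVField_apply_eq [FiniteDimensional ℝ E] [T2Space M]
    (x : M) (v : TangentSpace I x) : ∃ Z : VField I M, IsSmoothVField I Z ∧ Z x = v := by
  obtain ⟨s, hs, hv⟩ := FiberBundle.exists_contMDiffOn_extend (I := I) (k := ∞) (F := E)
    (V := fun y : M => TangentSpace I y) v
  obtain ⟨ψ, -, hψ⟩ := (SmoothBumpFunction.nhds_basis_tsupport (I := I) x).mem_iff.1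
    (interior_mem_nhds.2 hs)
  refine ⟨fun y => ψ y • FiberBundle.extend E v y,
    ContMDiffOn.smul_section_of_tsupport ψ.contMDiff.contMDiffOn isOpen_interior hψ
      (hv.mono interior_subset), ?_⟩
  simp

/-- The Lie bracket acts on functions as the commutator. This follows from the Jacobi identity for
`X`, `Y` and `f • Z` by comparing the coefficients of `Z`, for any field `Z` with `Z x ≠ 0`. -/
theorem dirDeriv_mlieBracket [FiniteDimensional ℝ E] [T2Space M] {X Y : VField I M} {f : M → ℝ}
    (hX : IsSmoothVField I X) (hY : IsSmoothVField I Y) (hf : ContMDiff I 𝓘(ℝ) ∞ f) (x : M) :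
    dirDeriv I (VectorField.mlieBracket I X Y) f x =
      dirDeriv I X (dirDeriv I Y f) x - dirDeriv I Y (dirDeriv I X f) x := by
  -- If the tangent space at `x` is trivial, there is no such `Z`, but both sides vanish.
  by_cases hv : ∀ v : TangentSpace I x, v = 0
  · simp only [dirDeriv, hv (VectorField.mlieBracket I X Y x), hv (X x), hv (Y x), map_zero,
      sub_zero]
  push Not at hv
  obtain ⟨v, hv⟩ := hv
  obtain ⟨Z, hZ, rfl⟩ := exists_isSmoothVField_apply_eq x v
  have : CompleteSpace E := FiniteDimensional.complete ℝ E
  have hsm : minSmoothness ℝ 2 ≤ (∞ : WithTop ℕ∞) := by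
    simpa using WithTop.coe_le_coe.2 (le_top : (2 : ℕ∞) ≤ ⊤)
  have : IsManifold I (minSmoothness ℝ 3) M :=
    IsManifold.of_le (n := ∞) (by simpa using WithTop.coe_le_coe.2 (le_top : (3 : ℕ∞) ≤ ⊤))
  have : IsManifold I (∞ + 1) M := ‹IsManifold I ∞ M›
  have hmd : ∀ {g : M → ℝ}, ContMDiff I 𝓘(ℝ) ∞ g → MDifferentiable I 𝓘(ℝ) g :=
    fun hg => hg.mdifferentiable (by simp)
  have hmd' : ∀ {W : VField I M}, IsSmoothVField I W →
      MDifferentiable I I.tangent fun y => (⟨y, W y⟩ : TangentBundle I M) :=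
    fun hW => ContMDiff.mdifferentiable hW (by simp)
  have hlie : ∀ {V W : VField I M}, IsSmoothVField I V → IsSmoothVField I W →
      IsSmoothVField I (VectorField.mlieBracket I V W) := fun hV hW =>
    ContDiff.mlieBracket_vectorField (m := ⊤) (n := ⊤) hV hW (by simp)
  have hsmul : ∀ {g : M → ℝ} {W : VField I M}, ContMDiff I 𝓘(ℝ) ∞ g → IsSmoothVField I W →
      IsSmoothVField I (g • W) := fun hg hW => ContMDiff.smul_section hg hW
  have hmul : ∀ {V W : VField I M} {g : M → ℝ}, ContMDiff I 𝓘(ℝ) ∞ g → IsSmoothVField I W →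
      VectorField.mlieBracket I V (g • W) =
        dirDeriv I V g • W + g • VectorField.mlieBracket I V W := fun hg hW =>
    funext fun y => VectorField.mlieBracket_smul_right (hmd hg y) (hmd' hW y)
  have hadd : ∀ {V W W' : VField I M}, IsSmoothVField I W → IsSmoothVField I W' →
      VectorField.mlieBracket I V (W + W') =
        VectorField.mlieBracket I V W + VectorField.mlieBracket I V W' := fun hW hW' =>
    funext fun y => VectorField.mlieBracket_add_right (hmd' hW y) (hmd' hW' y)
  have hXf := hX.contMDiff_dirDeriv hf
  have hYf := hY.contMDiff_dirDeriv hf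
  have h₁ := VectorField.leibniz_identity_mlieBracket_apply (hX.of_le hsm x) (hY.of_le hsm x)
    ((hsmul hf hZ).of_le hsm x)
  have h₂ := VectorField.leibniz_identity_mlieBracket_apply (hX.of_le hsm x) (hY.of_le hsm x)
    (hZ.of_le hsm x)
  rw [hmul hf hZ, hmul hf hZ, hmul hf hZ, hadd (hsmul hYf hZ) (hsmul hf (hlie hY hZ)),
    hadd (hsmul hXf hZ) (hsmul hf (hlie hX hZ)), hmul hYf hZ, hmul hXf hZ, hmul hf (hlie hY hZ),
    hmul hf (hlie hX hZ)] at h₁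
  simp only [Pi.add_apply, Pi.smul_apply', h₂, smul_add] at h₁
  refine smul_left_injective ℝ hv ?_
  simp only [sub_smul]
  rw [eq_sub_iff_add_eq]
  rw [← sub_eq_zero] at h₁ ⊢
  rw [← neg_eq_zero, ← h₁]
  abel

/-! ### Hamiltonian vector fields -/

namespace QCosymplecticStructure

variable {q : ℕ} (S : QCosymplecticStructure I q M)

theorem Ω_skew (x : M) (v w : TangentSpace I x) : S.Ω x v w = -S.Ω x w v := by
  have h := S.isTwoForm.2 x (v + w)
  simp only [map_add, add_apply, S.isTwoForm.2 x] at h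
  linarith

theorem Ω_reeb (x : M) (j : Fin q) : S.Ω x (S.reeb j x) = 0 := by
  have h := S.isReebFrame_reeb.tangent j x
  rw [← S.ker_Ω x] at h
  simpa using h

theorem lam_reeb (x : M) (i j : Fin q) : S.lam i x (S.reeb j x) = if i = j then 1 else 0 :=
  S.isReebFrame_reeb.dual i j x

/-- The distribution `ξ = ⋂ᵢ ker λᵢ` is involutive, since the `λᵢ` are closed. -/
theorem lam_mlieBracket {X Y : VField I M} (hX : IsSmoothVField I X) (hY : IsSmoothVField I Y)
    (hX₀ : ∀ i x, S.lam i x (X x) = 0) (hY₀ : ∀ i x, S.lam i x (Y x) = 0) (i : Fin q) (x : M) :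
    S.lam i x (VectorField.mlieBracket I X Y x) = 0 := by
  have h := S.closed_lam i X Y hX hY x
  simpa [extDeriv₁, dirDeriv, hX₀, hY₀, mvfderiv_const] using h

variable [FiniteDimensional ℝ E]

theorem eq_hamiltonianVField_iff (f : M → ℝ) (x : M) (v : TangentSpace I x) :
    (S.Ω x v = mvfderiv I f x - ∑ i, dirDeriv I (S.reeb i) f x • S.lam i x ∧
      ∀ i, S.lam i x v = 0) ↔ v = S.hamiltonianVField f x := by
  rw [hamiltonianVField, LinearEquiv.eq_symm_apply, flatEquiv_apply]
  constructor
  · rintro ⟨h, h₀⟩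
    simp [h, h₀]
  · intro h
    -- Evaluate on the Reeb fields: `Ω` and the right-hand side vanish there.
    have h₀ : ∀ j, S.lam j x v = 0 := by
      intro j
      have hj := congrArg (fun φ : TangentSpace I x →L[ℝ] ℝ => φ (S.reeb j x)) h
      simpa [S.Ω_skew x v, S.Ω_reeb, S.lam_reeb, dirDeriv] using hj
    refine ⟨?_, h₀⟩
    simpa [h₀] using h

theorem lam_hamiltonianVField (f : M → ℝ) (i : Fin q) (x : M) :
    S.lam i x (S.hamiltonianVField f x) = 0 :=
  ((S.eq_hamiltonianVField_iff f x _).2 rfl).2 i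

theorem Ω_hamiltonianVField (f : M → ℝ) (x : M) (w : TangentSpace I x)
    (hw : ∀ i, S.lam i x w = 0) : S.Ω x (S.hamiltonianVField f x) w = mvfderiv I f x w := by
  rw [((S.eq_hamiltonianVField_iff f x _).2 rfl).1]
  simp [hw]

theorem bracket_eq_dirDeriv (f g : M → ℝ) :
    S.bracket f g = dirDeriv I (S.hamiltonianVField g) f :=
  funext fun x => S.Ω_hamiltonianVField f x _ fun i => S.lam_hamiltonianVField g i x

theorem bracket_skew (f g : M → ℝ) : S.bracket f g = -S.bracket g f :=
  funext fun x => S.Ω_skew x _ _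

theorem isSmoothVField_hamiltonianVField {f : M → ℝ} (hf : ContMDiff I 𝓘(ℝ) ∞ f) :
    IsSmoothVField I (S.hamiltonianVField f) := by
  -- `φ` is `b` as a field of continuous linear maps.
  let φ : ∀ x : M, TangentSpace I x →L[ℝ] (TangentSpace I x →L[ℝ] ℝ) := fun x =>
    S.Ω x + ∑ i, (S.lam i x).smulRight (S.lam i x)
  have hφ : ∀ x v, φ x v = S.flatEquiv x v := fun x v => by
    simp [φ, flatEquiv_apply, sum_apply]
  refine contMDiff_of_clm_bundle_apply (F₁ := E) (F₂ := E →L[ℝ] ℝ)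
    (E₂ := fun x : M => TangentSpace I x →L[ℝ] Trivial M ℝ x)
    (φ := φ) (fun x => ?_) ?_ ?_
  · convert (S.flatEquiv x).bijective using 1
    exact funext (hφ x)
  · exact S.isTwoForm.1.add_section
      (ContMDiff.sum_section fun i _ => contMDiff_smulRight_section (S.isOneForm i) (S.isOneForm i))
  · have h : IsOneForm I fun x => mvfderiv I f x - ∑ i, dirDeriv I (S.reeb i) f x • S.lam i x :=
      (isOneForm_mvfderiv hf).sub_section (ContMDiff.sum_section fun i _ =>
        ((S.isReebFrame_reeb.smooth i).contMDiff_dirDeriv hf).smul_section (S.isOneForm i))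
    have hb : (fun x => φ x (S.hamiltonianVField f x)) =
        fun x => mvfderiv I f x - ∑ i, dirDeriv I (S.reeb i) f x • S.lam i x :=
      funext fun x => by rw [hφ, hamiltonianVField, LinearEquiv.apply_symm_apply]
    rw [← hb] at h
    exact h

/-! ### The bracket -/

theorem contMDiff_bracket {f g : M → ℝ} (hf : ContMDiff I 𝓘(ℝ) ∞ f) (hg : ContMDiff I 𝓘(ℝ) ∞ g) :
    ContMDiff I 𝓘(ℝ) ∞ (S.bracket f g) :=
  S.isTwoForm.contMDiff_apply (S.isSmoothVField_hamiltonianVField hf)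
    (S.isSmoothVField_hamiltonianVField hg)

/-- Every vector of `ξ` extends to a global smooth vector field with values in `ξ`: project an
arbitrary extension to `ξ` along the Reeb fields. -/
theorem exists_horizontal_apply_eq [T2Space M] (x : M) (v : TangentSpace I x)
    (hv : ∀ i, S.lam i x v = 0) : ∃ Z : VField I M, IsSmoothVField I Z ∧
      (∀ i y, S.lam i y (Z y) = 0) ∧ Z x = v := by
  obtain ⟨Z, hZ, hZx⟩ := exists_isSmoothVField_apply_eq x v
  refine ⟨fun y => Z y - ∑ j, S.lam j y (Z y) • S.reeb j y,
    ContMDiff.sub_section hZ (ContMDiff.sum_section fun j _ =>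
      ((S.isOneForm j).contMDiff_apply hZ).smul_section (S.isReebFrame_reeb.smooth j)), ?_, ?_⟩
  · intro i y
    simp [S.lam_reeb]
  · simp [hZx, hv]

theorem hamiltonianVField_bracket [T2Space M] {f g : M → ℝ}
    (hf : ContMDiff I 𝓘(ℝ) ∞ f) (hg : ContMDiff I 𝓘(ℝ) ∞ g) (x : M) :
    S.hamiltonianVField (S.bracket f g) x =
      -VectorField.mlieBracket I (S.hamiltonianVField f) (S.hamiltonianVField g) x := by
  set X := S.hamiltonianVField f
  set Y := S.hamiltonianVField g
  have hX : IsSmoothVField I X := S.isSmoothVField_hamiltonianVField hf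
  have hY : IsSmoothVField I Y := S.isSmoothVField_hamiltonianVField hg
  have hX₀ : ∀ i x, S.lam i x (X x) = 0 := S.lam_hamiltonianVField f
  have hY₀ : ∀ i x, S.lam i x (Y x) = 0 := S.lam_hamiltonianVField g
  -- On `ξ`, the identity is `dΩ(X, Y, Z) = 0` for a field `Z` in `ξ` through the given vector.
  have hhor : ∀ v, (∀ i, S.lam i x v = 0) →
      S.Ω x (VectorField.mlieBracket I X Y x) v = -mvfderiv I (S.bracket f g) x v := by
    intro v hv
    obtain ⟨Z, hZ, hZ₀, rfl⟩ := S.exists_horizontal_apply_eq x v hv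
    have hd := S.closed_Ω X Y Z hX hY hZ x
    have hYZ : (fun y => S.Ω y (Y y) (Z y)) = dirDeriv I Z g :=
      funext fun y => S.Ω_hamiltonianVField g y _ fun i => hZ₀ i y
    have hXZ : (fun y => S.Ω y (X y) (Z y)) = dirDeriv I Z f :=
      funext fun y => S.Ω_hamiltonianVField f y _ fun i => hZ₀ i y
    have hXY : (fun y => S.Ω y (X y) (Y y)) = S.bracket f g := rfl
    have hXZY : S.Ω x (VectorField.mlieBracket I X Z x) (Y x) =
        -dirDeriv I (VectorField.mlieBracket I X Z) g x := by
      rw [S.Ω_skew, S.Ω_hamiltonianVField g x _ fun i => S.lam_mlieBracket hX hZ hX₀ hZ₀ i x]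
      rfl
    have hYZX : S.Ω x (VectorField.mlieBracket I Y Z x) (X x) =
        -dirDeriv I (VectorField.mlieBracket I Y Z) f x := by
      rw [S.Ω_skew, S.Ω_hamiltonianVField f x _ fun i => S.lam_mlieBracket hY hZ hY₀ hZ₀ i x]
      rfl
    have hXg : dirDeriv I X g = -S.bracket f g := by
      rw [← S.bracket_eq_dirDeriv, S.bracket_skew]
    have hYf : dirDeriv I Y f = S.bracket f g := (S.bracket_eq_dirDeriv f g).symm
    rw [extDeriv₂, hYZ, hXZ, hXY, hXZY, hYZX, dirDeriv_mlieBracket hX hZ hg,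
      dirDeriv_mlieBracket hY hZ hf, hXg, hYf] at hd
    have hneg : dirDeriv I Z (-S.bracket f g) x = -dirDeriv I Z (S.bracket f g) x := by
      simp [dirDeriv, mvfderiv_neg]
    rw [hneg] at hd
    change _ = -dirDeriv I Z (S.bracket f g) x
    linarith
  symm
  refine (S.eq_hamiltonianVField_iff _ x _).1 ⟨?_, fun i => ?_⟩
  · ext v
    -- Apply `hhor` to the component of `v` in `ξ`; the Reeb component does not contribute to `Ω`.
    have hw := hhor (v - ∑ j, S.lam j x v • S.reeb j x) fun i => by simp [S.lam_reeb]
    have hR : ∀ u j, S.Ω x u (S.reeb j x) = 0 := fun u j => by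
      rw [S.Ω_skew, S.Ω_reeb]; simp
    simp only [map_sub, map_sum, map_smul, hR] at hw
    change S.Ω x (-VectorField.mlieBracket I X Y x) v = _
    rw [map_neg, neg_apply]
    simp only [smul_eq_mul, mul_zero, Finset.sum_const_zero, sub_zero] at hw
    rw [hw, neg_neg]
    simp [dirDeriv, sum_apply, mul_comm]
  · rw [map_neg, S.lam_mlieBracket hX hY hX₀ hY₀ i x, neg_zero]

theorem bracket_jacobi [T2Space M] {f g h : M → ℝ} (hf : ContMDiff I 𝓘(ℝ) ∞ f)
    (hg : ContMDiff I 𝓘(ℝ) ∞ g) (hh : ContMDiff I 𝓘(ℝ) ∞ h) (x : M) :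
    S.bracket (S.bracket f g) h x + S.bracket (S.bracket g h) f x +
      S.bracket (S.bracket h f) g x = 0 := by
  have hneg : ∀ (X : VField I M) (u : M → ℝ), dirDeriv I X (-u) x = -dirDeriv I X u x :=
    fun X u => by simp [dirDeriv, mvfderiv_neg]
  have h₁ : S.bracket (S.bracket f g) h x = dirDeriv I (VectorField.mlieBracket I
      (S.hamiltonianVField f) (S.hamiltonianVField g)) h x := by
    rw [S.bracket_skew, S.bracket_eq_dirDeriv h, Pi.neg_apply, dirDeriv,
      S.hamiltonianVField_bracket hf hg, map_neg, neg_neg, dirDeriv]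
  rw [h₁, dirDeriv_mlieBracket (S.isSmoothVField_hamiltonianVField hf)
      (S.isSmoothVField_hamiltonianVField hg) hh,
    S.bracket_eq_dirDeriv _ f, S.bracket_eq_dirDeriv _ g, S.bracket_skew g h, hneg,
    S.bracket_eq_dirDeriv h g, S.bracket_eq_dirDeriv h f]
  ring

end QCosymplecticStructure

end QCosymplectic

theorem mainTheorem3 {n q : ℕ} (hn : 0 < n) (hq : 0 < q)
    {E : Type*} [NormedAddCommGroup E] [NormedSpace ℝ E] [FiniteDimensional ℝ E]
    (hdim : Module.finrank ℝ E = 2 * n + q)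
    {H : Type*} [TopologicalSpace H] (I : ModelWithCorners ℝ E H) [I.Boundaryless]
    {M : Type*} [TopologicalSpace M] [ChartedSpace H M] [IsManifold I ∞ M]
    [T2Space M] [SecondCountableTopology M]
    (S : QCosymplectic.QCosymplecticStructure I q M) :
    -- `X_f` is the unique vector field with `i_{X_f} Ω = df - ∑ (R_i f) λ_i`, `λ_i(X_f) = 0`;
    -- it is smooth
    (∀ f : C^∞⟮I, M; 𝓘(ℝ), ℝ⟯,
      QCosymplectic.IsSmoothVField I (S.hamiltonianVField f) ∧
      ∀ (x : M) (v : TangentSpace I x),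
        (S.Ω x v = mvfderiv I f x
            - ∑ i, QCosymplectic.dirDeriv I (S.reeb i) f x • S.lam i x ∧
          ∀ i, S.lam i x v = 0) ↔
        v = S.hamiltonianVField f x) ∧
    -- the bracket is a Poisson bracket on `C^∞(M)`
    ∃ B : C^∞⟮I, M; 𝓘(ℝ), ℝ⟯ → C^∞⟮I, M; 𝓘(ℝ), ℝ⟯ → C^∞⟮I, M; 𝓘(ℝ), ℝ⟯,
      (∀ f g x, B f g x = S.bracket f g x) ∧
      QCosymplectic.IsPoissonBracket B ∧
      -- `X_{ {f, g} } = -[X_f, X_g]`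
      ∀ f g x, S.hamiltonianVField (B f g) x =
        - VectorField.mlieBracket I (S.hamiltonianVField f) (S.hamiltonianVField g) x := by
  have hs : ∀ f : C^∞⟮I, M; 𝓘(ℝ), ℝ⟯, ContMDiff I 𝓘(ℝ) ∞ f := fun f => f.contMDiff
  have hd : ∀ (f : C^∞⟮I, M; 𝓘(ℝ), ℝ⟯) x, MDifferentiableAt I 𝓘(ℝ) f x := fun f x =>
    f.mdifferentiableAt
  refine ⟨fun f => ⟨S.isSmoothVField_hamiltonianVField (hs f), S.eq_hamiltonianVField_iff f⟩,
    fun f g => ⟨S.bracket f g, S.contMDiff_bracket (hs f) (hs g)⟩, fun _ _ _ => rfl, ?_,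
    fun f g => S.hamiltonianVField_bracket (hs f) (hs g)⟩
  have hadd : ∀ (f g h : C^∞⟮I, M; 𝓘(ℝ), ℝ⟯) x,
      S.bracket (f + g : C^∞⟮I, M; 𝓘(ℝ), ℝ⟯) h x = S.bracket f h x + S.bracket g h x := by
    intro f g h x
    simp only [S.bracket_eq_dirDeriv, QCosymplectic.dirDeriv]
    rw [ContMDiffMap.coe_add, mvfderiv_add (hd f x) (hd g x), add_apply]
  have hsmul : ∀ (c : ℝ) (f g : C^∞⟮I, M; 𝓘(ℝ), ℝ⟯) x,
      S.bracket (c • f : C^∞⟮I, M; 𝓘(ℝ), ℝ⟯) g x = c * S.bracket f g x := by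
    intro c f g x
    simp only [S.bracket_eq_dirDeriv, QCosymplectic.dirDeriv]
    have hc : ((c • f : C^∞⟮I, M; 𝓘(ℝ), ℝ⟯) : M → ℝ) =
        (fun _ : M => c) * (f : M → ℝ) := rfl
    rw [hc, mvfderiv_mul mdifferentiableAt_const (hd f x)]
    simp [mvfderiv_const]
  have hskew : ∀ (f g : M → ℝ) x, S.bracket f g x = -S.bracket g f x := fun f g x =>
    congrFun (S.bracket_skew f g) x
  constructor
  · exact fun f g h => ContMDiffMap.ext (hadd f g h)
  · exact fun c f g => ContMDiffMap.ext (hsmul c f g)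
  · refine fun f g h => ContMDiffMap.ext fun x => ?_
    change S.bracket _ _ x = S.bracket _ _ x + S.bracket _ _ x
    rw [hskew, hadd, hskew f g, hskew f h, neg_add]
  · refine fun c f g => ContMDiffMap.ext fun x => ?_
    change S.bracket _ _ x = c * S.bracket _ _ x
    rw [hskew, hsmul, hskew f g, mul_neg]
  · exact fun f g => ContMDiffMap.ext (hskew f g)
  · exact fun f g h => ContMDiffMap.ext (S.bracket_jacobi (hs f) (hs g) (hs h))
  · refine fun f g h => ContMDiffMap.ext fun x => ?_
    change S.bracket _ _ x = f x * S.bracket _ _ x + g x * S.bracket _ _ x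
    simp only [S.bracket_eq_dirDeriv, QCosymplectic.dirDeriv]
    rw [ContMDiffMap.coe_mul, mvfderiv_mul (hd f x) (hd g x)]
    rfl
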